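/- For integers $m\ge 3$ and $c$, let $P(m,c)=\frac{c}{2}\{(m-2)c-(m-4)\}$ be the $c$th $m$-gonal number, where the index $c$ ranges over the positive integers if $m=3$ or $m=4$, and over all integers if $m>4$. For positive integers $t$ and $n$, let $r_{m,t}(n)$ denote the number of representations $n=a+b$ with positive integers $a,b$ (disregarding the order of $a$ and $b$) such that $ab=tP(m,c)$ for some such index $c$. Let $\mathbb{P}$ be the set of prime numbers and $k\mathbb{P}=\{kp: p\in\mathbb{P}\}$. Then for every positive integer $n$: 1. $r_{3,1}(n)=0$ iff $2n^2+1\in \mathbb{P}$; 2. $r_{5,1}(n)=0$ iff $6n^2+1\in \mathbb{P}$; 3. $r_{7,1}(n)=0$ iff $10n^2+9\in \mathbb{P}\cup 9\mathbb{P}$; 4. $r_{13,1}(n)=0$ iff $22n^2+81\in \mathbb{P}\cup 9\mathbb{P}\cup 81\mathbb{P}$; 5. $r_{31,1}(n)=0$ iff $58n^2+729\in \mathbb{P}\cup 9\mathbb{P}\cup 81\mathbb{P}\cup 729\mathbb{P}$; 6. $r_{3,2}(n)=0$ iff $n^2+1\in \mathbb{P}$; 7. $r_{8,2}(n)=0$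 iff $3n^2+8\in \mathbb{P}\cup 4\mathbb{P}\cup 8\mathbb{P}$; 8. $r_{12,2}(n)=0$ iff $5n^2+32\in \mathbb{P}\cup 4\mathbb{P}\cup 16\mathbb{P}\cup 32\mathbb{P}$; 9. $r_{24,2}(n)=0$ iff $11n^2+200\in \mathbb{P}\cup 4\mathbb{P}\cup 8\mathbb{P}\cup 25\mathbb{P}\cup 100\mathbb{P}\cup 200\mathbb{P}$; 10. $r_{60,2}(n)=0$ iff $29n^2+1568\in \mathbb{P}\cup 4\mathbb{P}\cup 16\mathbb{P}\cup 32\mathbb{P}\cup 49\mathbb{P}\cup 196\mathbb{P}\cup 784\mathbb{P}\cup 1568\mathbb{P}$; 11. $r_{3,3}(n)=0$ iff $2n^2+3\in \mathbb{P}\cup 3\mathbb{P}$; 12. $r_{3,5}(n)=0$ iff $2n^2+5\in \mathbb{P}\cup 5\mathbb{P}$; 13. $r_{3,11}(n)=0$ iff $2n^2+11\in \mathbb{P}\cup 11\mathbb{P}$; 14. $r_{3,29}(n)=0$ iff $2n^2+29\in \mathbb{P}\cup 29\mathbb{P}$. -/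

import Mathlib

/-- The `c`th `m`-gonal number `P(m,c) = (c/2) ((m-2)c - (m-4))`, as a rational number. -/
def polygonal (m : ℕ) (c : ℤ) : ℚ :=
  (c : ℚ) / 2 * (((m : ℚ) - 2) * c - ((m : ℚ) - 4))

/-- The admissible indices `c` of the `m`-gonal numbers (`3 ≤ m`): the positive integers
if `m = 3` or `m = 4`, and all integers if `4 < m`. -/
def IsPolygonalIndex (m : ℕ) (c : ℤ) : Prop :=
  4 < m ∨ 0 < c

open Classical in
/-- `r_{m,t}(n)`: the number of representations `n = a + b` of `n` as a sum of two positive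
integers, the order of the summands being disregarded (`a ≤ b`), such that `a b = t P(m,c)`
for some admissible index `c`. -/
noncomputable def polyRepr (m t n : ℕ) : ℕ :=
  ((Finset.HasAntidiagonal.antidiagonal n).filter fun q : ℕ × ℕ =>
    0 < q.1 ∧ 0 < q.2 ∧ q.1 ≤ q.2 ∧
      ∃ c : ℤ, IsPolygonalIndex m c ∧ (q.1 : ℚ) * (q.2 : ℚ) = (t : ℚ) * polygonal m c).card

/-- The set of prime numbers. -/
def primeSet : Set ℕ := {p | p.Prime}

/-- The set `k ℙ = {k p : p prime}`. -/
def scaledPrimes (k : ℕ) : Set ℕ := (fun p => k * p) '' primeSet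

/-!
Completing the square in `n ^ 2 = (b - a) ^ 2 + 4 a b` with `a b = t P(m, c)` shows that
`r_{m,t}(n) = 0` means that a number `N = A n ^ 2 + B e ^ 2` has, up to signs, only this one
representation by the form `A x ^ 2 + B y ^ 2`. In all cases of the theorem every reduced form of
determinant `D = A B` is diagonal. If `N` is prime to `D` and `n` to `e`, then every prime factor
`p` of `N` divides some `s ^ 2 + D`, hence is represented by a diagonal form of determinant `D`;
dividing the representation of `N` by that of `p` and multiplying back in the two ways allowed by
Brahmagupta's identity gives a second representation unless `N = p`. The sets `k ℙ` arise from the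
two ways in which coprimality can fail: the form is anisotropic at the primes dividing `e`, so a
common divisor `d` of `n` and `e` can be cancelled and contributes `d ^ 2`, and a prime `r = B`
dividing `n` turns the form into `A r x ^ 2 + y ^ 2` and contributes `r`.
-/

/-- Every reduced form `a x ^ 2 + 2 b x y + c y ^ 2` of determinant `a c - b ^ 2 = D` is diagonal.
Imprimitive forms are included, so for positive `D` this is stronger than `D` being one of Euler's
idoneal numbers: it rules out reduced forms with `2 |b| = a` or `a = c`. -/
def AllReducedDiagonal (D : ℤ) : Prop :=
  ∀ a b c : ℤ, 2 * |b| ≤ a → a ≤ c → a * c - b ^ 2 = D → b = 0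

theorem allReducedDiagonal_of_forall_not_dvd {D : ℕ}
    (h : ∀ b ∈ Finset.Icc 1 (D / 3), ∀ a ∈ Finset.Icc (2 * b) D,
      a ^ 2 ≤ D + b ^ 2 → ¬ a ∣ D + b ^ 2) : AllReducedDiagonal D := by
  intro a b c hb hac hdet
  by_contra hne
  have hb1 : 1 ≤ |b| := Int.one_le_abs hne
  rw [← sq_abs b] at hdet
  lift |b| to ℕ using abs_nonneg b with β
  lift a to ℕ using by omega
  lift c to ℕ using by omega
  norm_cast at hb hac hb1
  have hmul : D + β ^ 2 = a * c := by zify; linarith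
  have hsq : a ^ 2 ≤ D + β ^ 2 := by rw [hmul, pow_two]; exact Nat.mul_le_mul_left a hac
  have hβD : β ≤ D / 3 := by
    rw [Nat.le_div_iff_mul_le three_pos]
    nlinarith
  have haD : a ≤ D := by nlinarith
  exact h β (Finset.mem_Icc.2 ⟨hb1, hβD⟩) a (Finset.mem_Icc.2 ⟨hb, haD⟩) hsq ⟨c, hmul⟩

theorem exists_two_mul_abs_add_mul_le {a : ℤ} (ha : 0 < a) (b : ℤ) :
    ∃ k : ℤ, 2 * |b + a * k| ≤ a := by
  lift a to ℕ using ha.le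
  have hlower := Int.le_bmod (x := b) (Int.natCast_pos.1 ha)
  have hupper := Int.bmod_le (x := b) (Int.natCast_pos.1 ha)
  have hsplit := Int.bmod_add_bdiv b a
  refine ⟨-b.bdiv a, ?_⟩
  rw [show b + a * -b.bdiv a = b.bmod a by linarith]
  rcases abs_cases (b.bmod a) with ⟨habs, -⟩ | ⟨habs, -⟩ <;> omega

/-- Lagrange's reduction: translate the middle coefficient into `[-a / 2, a / 2]` and, as long as
the form is not reduced, exchange the outer coefficients, which decreases `a`. -/
theorem AllReducedDiagonal.exists_diagonal {D : ℤ} (hD : AllReducedDiagonal D) (hD0 : 0 < D)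
    (a b c : ℤ) (ha : 0 < a) (hdet : a * c - b ^ 2 = D) :
    ∃ A B : ℤ, A * B = D ∧
      ∀ x y : ℤ, ∃ z w : ℤ, a * x ^ 2 + 2 * b * x * y + c * y ^ 2 = A * z ^ 2 + B * w ^ 2 := by
  obtain ⟨k, hk⟩ := exists_two_mul_abs_add_mul_le ha b
  obtain ⟨b', hb'⟩ : ∃ b', b' = b + a * k := ⟨_, rfl⟩
  obtain ⟨c', hc'⟩ : ∃ c', c' = c + 2 * b * k + a * k ^ 2 := ⟨_, rfl⟩
  have hdet' : a * c' - b' ^ 2 = D := by rw [← hdet, hb', hc']; ring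
  have htranslate (x y : ℤ) : a * x ^ 2 + 2 * b * x * y + c * y ^ 2 =
      a * (x - k * y) ^ 2 + 2 * b' * (x - k * y) * y + c' * y ^ 2 := by
    rw [hb', hc']; ring
  by_cases hac : a ≤ c'
  · have hb0 : b' = 0 := hD a b' c' (hb' ▸ hk) hac hdet'
    exact ⟨a, c', by rw [← hdet', hb0]; ring,
      fun x y => ⟨x - k * y, y, by rw [htranslate, hb0]; ring⟩⟩
  · have hc0 : 0 < c' := pos_of_mul_pos_right (by linarith [sq_nonneg b'] : 0 < a * c') ha.le
    obtain ⟨A, B, hAB, hrep⟩ := exists_diagonal hD hD0 c' b' a hc0 (by rw [mul_comm, hdet'])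
    refine ⟨A, B, hAB, fun x y => ?_⟩
    obtain ⟨z, w, hzw⟩ := hrep y (x - k * y)
    exact ⟨z, w, by rw [htranslate, ← hzw]; ring⟩
termination_by a.toNat
decreasing_by omega

theorem AllReducedDiagonal.exists_rep_of_dvd_sq_add {D u s : ℤ} (hD : AllReducedDiagonal D)
    (hD0 : 0 < D) (hu : 0 < u) (hdvd : u ∣ s ^ 2 + D) :
    ∃ A B a b : ℤ, A * B = D ∧ u = A * a ^ 2 + B * b ^ 2 := by
  obtain ⟨c, hc⟩ := hdvd
  obtain ⟨A, B, hAB, hrep⟩ := hD.exists_diagonal hD0 u s c hu (by linarith)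
  obtain ⟨a, b, hab⟩ := hrep 1 0
  exact ⟨A, B, a, b, hAB, by linarith⟩

/-- The representation of `A n ^ 2 + B e ^ 2` by the form `A x ^ 2 + B y ^ 2` is unique up to
signs. For positive `B` the value of `y ^ 2` is determined by that of `x ^ 2`, so only the latter
is required. -/
def IsUniqueRep (A B n e : ℤ) : Prop :=
  ∀ x y : ℤ, A * x ^ 2 + B * y ^ 2 = A * n ^ 2 + B * e ^ 2 → x ^ 2 = n ^ 2

theorem isUniqueRep_of_prime {A B n e : ℤ} (hp : Prime (A * n ^ 2 + B * e ^ 2))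
    (hA : ¬ A * n ^ 2 + B * e ^ 2 ∣ A) (hAB : 2 ≤ A * B) : IsUniqueRep A B n e := by
  obtain ⟨N, hN⟩ : ∃ N, N = A * n ^ 2 + B * e ^ 2 := ⟨_, rfl⟩
  rw [← hN] at hp hA
  -- Brahmagupta's identity writes `N ^ 2` as `X ^ 2 + A B (n y - e x) ^ 2`.
  have sq_eq_of_dvd (x y : ℤ) (hxy : A * x ^ 2 + B * y ^ 2 = N) (hdvd : N ∣ n * y - e * x) :
      x ^ 2 = n ^ 2 := by
    obtain ⟨w, hw⟩ := hdvd
    have hbrahmagupta : (A * n * x + B * e * y) ^ 2 + A * B * w ^ 2 * N ^ 2 = N ^ 2 := by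
      have hprod : (A * n * x + B * e * y) ^ 2 + A * B * (n * y - e * x) ^ 2 = N * N := by
        nth_rw 1 [hN]
        rw [← hxy]
        ring
      rw [hw] at hprod
      linear_combination hprod
    have hN2 : 0 < N ^ 2 := by have := hp.ne_zero; positivity
    have hw0 : w = 0 := by
      by_contra hne
      have hw1 : 0 < w ^ 2 := by positivity
      have hAw : 2 ≤ A * B * w ^ 2 := by nlinarith
      nlinarith [sq_nonneg (A * n * x + B * e * y), mul_le_mul_of_nonneg_right hAw hN2.le]
    have hcross : n * y = e * x := by rw [hw0] at hw; linarith
    apply mul_right_cancel₀ hp.ne_zero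
    calc x ^ 2 * N = A * x ^ 2 * n ^ 2 + B * (e * x) ^ 2 := by rw [hN]; ring
      _ = n ^ 2 * N := by rw [← hcross, ← hxy]; ring
  intro x y hxy
  rw [← hN] at hxy
  have hdvd : N ∣ A * ((n * y - e * x) * (n * y - e * -x)) :=
    ⟨y ^ 2 - e ^ 2, by linear_combination (y ^ 2) * hN.symm - e ^ 2 * hxy⟩
  rcases hp.dvd_or_dvd ((hp.dvd_or_dvd hdvd).resolve_left hA) with h | h
  · exact sq_eq_of_dvd x y hxy h
  · rw [← neg_sq x]
    exact sq_eq_of_dvd (-x) y (by rwa [neg_sq]) h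

theorem exists_dvd_sq_add_mul {p A B n e : ℤ} (hp : Prime p) (hA : ¬ p ∣ A)
    (hne : IsCoprime n e) (hdvd : p ∣ A * n ^ 2 + B * e ^ 2) : ∃ s : ℤ, p ∣ s ^ 2 + A * B := by
  have hpe : ¬ p ∣ e := by
    intro hpe
    have hpn : p ∣ A * n ^ 2 := (dvd_add_left (hpe.pow two_ne_zero |>.mul_left B)).1 hdvd
    exact hp.not_isUnit (hne.isUnit_of_dvd'
      (hp.dvd_of_dvd_pow ((hp.dvd_or_dvd hpn).resolve_left hA)) hpe)
  obtain ⟨i, j, hij⟩ := hp.coprime_iff_not_dvd.2 hpe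
  obtain ⟨k, hk⟩ := hdvd
  exact ⟨A * n * j, A * j ^ 2 * k + A * B * i * (1 + j * e),
    by linear_combination A * j ^ 2 * hk - A * B * (1 + j * e) * hij⟩

theorem exists_eq_mul_of_mul_eq_mul {n e a b : ℤ} (hne : IsCoprime n e) (h : n * b = e * a) :
    ∃ t : ℤ, a = n * t ∧ b = e * t := by
  obtain ⟨i, j, hij⟩ := hne
  exact ⟨i * a + j * b, by linear_combination -a * hij - j * h,
    by linear_combination -b * hij + i * h⟩

theorem mul_ne_mul_of_rep_mul {A B n e a b p v : ℤ} (hne : IsCoprime n e) (hp0 : p ≠ 0)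
    (hv : 1 < v) (hN : p * v = A * n ^ 2 + B * e ^ 2) (hp : p = A * a ^ 2 + B * b ^ 2) :
    n * b ≠ e * a := by
  intro h
  obtain ⟨t, rfl, rfl⟩ := exists_eq_mul_of_mul_eq_mul hne h
  have hvt : v * t ^ 2 = 1 :=
    mul_left_cancel₀ hp0 (by linear_combination t ^ 2 * hN - hp)
  exact absurd (Int.eq_one_of_mul_eq_one_right (by omega) hvt) hv.ne'

theorem ne_zero_of_prime_eq {A B a b p : ℤ} (hp : Prime p) (hB : ¬ p ∣ B)
    (h : p = A * a ^ 2 + B * b ^ 2) : a ≠ 0 := by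
  rintro rfl
  have hpb : p ∣ B * b ^ 2 := ⟨1, by linear_combination -h⟩
  obtain ⟨t, rfl⟩ := hp.dvd_of_dvd_pow ((hp.dvd_or_dvd hpb).resolve_left hB)
  refine hp.not_isUnit (IsUnit.of_mul_eq_one (B * t ^ 2) ?_)
  exact mul_left_cancel₀ hp.ne_zero (by linear_combination -h)

/-- Euler's division of a represented number by a represented prime, for forms whose coefficients
have a common refinement `A = α β`, `B = γ δ`, `C = α γ`, `E = β δ`. -/
theorem exists_quotient_rep {p v α β γ δ n e a b : ℤ} (hp : Prime p) (hα : ¬ p ∣ α)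
    (hβ : ¬ p ∣ β) (hγ : ¬ p ∣ γ) (hN : p * v = α * β * n ^ 2 + γ * δ * e ^ 2)
    (hpab : p = α * γ * a ^ 2 + β * δ * b ^ 2) :
    ∃ b' x y : ℤ, b' ^ 2 = b ^ 2 ∧ p * x = α * n * a + δ * e * b' ∧
      p * y = β * n * b' - γ * e * a ∧ v = β * γ * x ^ 2 + α * δ * y ^ 2 := by
  have hdvd : p ∣ α * ((β * n * b - γ * e * a) * (β * n * -b - γ * e * a)) :=
    ⟨γ * e ^ 2 - β * b ^ 2 * v, by linear_combination β * b ^ 2 * hN - γ * e ^ 2 * hpab⟩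
  obtain ⟨b', hb', y, hy⟩ : ∃ b', b' ^ 2 = b ^ 2 ∧ p ∣ β * n * b' - γ * e * a := by
    rcases hp.dvd_or_dvd ((hp.dvd_or_dvd hdvd).resolve_left hα) with h | h
    · exact ⟨b, rfl, h⟩
    · exact ⟨-b, neg_sq b, h⟩
  have hbrahmagupta : p * (p * v) =
      β * γ * (α * n * a + δ * e * b') ^ 2 + α * δ * (β * n * b' - γ * e * a) ^ 2 := by
    rw [hN]
    nth_rw 1 [hpab]
    rw [← hb']
    ring
  have hβγ : p ∣ β * γ * (α * n * a + δ * e * b') ^ 2 :=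
    ⟨p * v - α * δ * p * y ^ 2, by rw [hy] at hbrahmagupta; linear_combination -hbrahmagupta⟩
  obtain ⟨x, hx⟩ := hp.dvd_of_dvd_pow
    ((hp.dvd_or_dvd hβγ).resolve_left (hp.not_dvd_mul hβ hγ))
  refine ⟨b', x, y, hb', hx.symm, hy.symm, ?_⟩
  rw [hx, hy] at hbrahmagupta
  exact mul_left_cancel₀ (mul_ne_zero hp.ne_zero hp.ne_zero) (by linear_combination hbrahmagupta)

theorem eq_of_eq_mul_sq {c d x v : ℤ} (h : v = c * d * x ^ 2) (hv : 0 < v)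
    (hunit : IsUnit (c * d)) : c ≠ 0 ∧ c = d := by
  have hcd : c * d = 1 := (Int.isUnit_iff.1 hunit).resolve_right fun hneg => by
    rw [hneg] at h
    linarith [sq_nonneg x]
  refine ⟨left_ne_zero_of_mul_eq_one hcd, ?_⟩
  rcases Int.eq_one_or_neg_one_of_mul_eq_one' hcd with ⟨rfl, rfl⟩ | ⟨rfl, rfl⟩ <;> rfl

/-- Brahmagupta's identity multiplies representations of the factors in two ways, and the two
products have different squares of the first variable. -/
theorem not_isUniqueRep_of_rep_mul_rep {α β γ δ n e a b x y p v : ℤ}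
    (hN : p * v = α * β * n ^ 2 + γ * δ * e ^ 2)
    (hp : p = α * γ * a ^ 2 + β * δ * b ^ 2) (hv : v = β * γ * x ^ 2 + α * δ * y ^ 2)
    (hγδ : γ * δ ≠ 0) (ha : a ≠ 0) (hb : b ≠ 0) (hx : x ≠ 0) (hy : y ≠ 0) :
    ¬ IsUniqueRep (α * β) (γ * δ) n e := by
  intro hunique
  have hplus := hunique (γ * a * x + δ * b * y) (α * a * y - β * b * x) (by
    linear_combination hN - (β * γ * x ^ 2 + α * δ * y ^ 2) * hp - p * hv)
  have hminus := hunique (γ * a * x - δ * b * y) (α * a * y + β * b * x) (by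
    linear_combination hN - (β * γ * x ^ 2 + α * δ * y ^ 2) * hp - p * hv)
  have hdiff : 4 * (γ * δ) * a * b * x * y = 0 := by linear_combination hplus - hminus
  simp_all

theorem not_isUniqueRep_of_prime_factor {α β γ δ n e a b p v : ℤ} (hne : IsCoprime n e)
    (hcop : IsCoprime (p * v) (α * β * (γ * δ))) (hp : Prime p) (hv : 1 < v)
    (hN : p * v = α * β * n ^ 2 + γ * δ * e ^ 2)
    (hpab : p = α * γ * a ^ 2 + β * δ * b ^ 2) (hAB : α * β * (γ * δ) ≠ 0) :
    ¬ IsUniqueRep (α * β) (γ * δ) n e := by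
  have hunit {d : ℤ} (hd : d ∣ α * β * (γ * δ)) (hdN : d ∣ p * v) : IsUnit d :=
    hcop.isUnit_of_dvd' hdN hd
  have hpnot {d : ℤ} (hd : d ∣ α * β * (γ * δ)) : ¬ p ∣ d := fun h =>
    hp.not_isUnit (hunit (h.trans hd) (dvd_mul_right p v))
  obtain ⟨b', x, y, hb', hx, hy, hvxy⟩ := exists_quotient_rep hp
    (hpnot ⟨β * (γ * δ), by ring⟩) (hpnot ⟨α * (γ * δ), by ring⟩)
    (hpnot ⟨α * β * δ, by ring⟩) hN hpab
  rw [← hb'] at hpab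
  have ha0 : a ≠ 0 := ne_zero_of_prime_eq hp (hpnot ⟨α * γ, by ring⟩) hpab
  have hb0 : b' ≠ 0 :=
    ne_zero_of_prime_eq hp (hpnot ⟨β * δ, by ring⟩) (hpab.trans (add_comm _ _))
  have hy0 : y ≠ 0 := by
    rintro rfl
    have hv' : v = β * γ * x ^ 2 := by linear_combination hvxy
    obtain ⟨hβ, rfl⟩ := eq_of_eq_mul_sq hv' (by omega)
      (hunit ⟨α * δ, by ring⟩ ⟨p * x ^ 2, by rw [hv']; ring⟩)
    exact mul_ne_mul_of_rep_mul hne hp.ne_zero hv hN hpab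
      (mul_left_cancel₀ hβ (by linear_combination -hy))
  have hx0 : x ≠ 0 := by
    rintro rfl
    have hv' : v = α * δ * y ^ 2 := by linear_combination hvxy
    obtain ⟨hα, rfl⟩ := eq_of_eq_mul_sq hv' (by omega)
      (hunit ⟨β * γ, by ring⟩ ⟨p * y ^ 2, by rw [hv']; ring⟩)
    exact mul_ne_mul_of_rep_mul (a := -b') (b := a) hne hp.ne_zero hv hN
      (by linear_combination hpab) (mul_left_cancel₀ hα (by linear_combination -hx))
  exact not_isUniqueRep_of_rep_mul_rep hN hpab hvxy (right_ne_zero_of_mul hAB) ha0 hb0 hx0 hy0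

theorem AllReducedDiagonal.isUniqueRep_iff_prime {A B n e : ℤ} (hD : AllReducedDiagonal (A * B))
    (hAB : 2 ≤ A * B) (hne : IsCoprime n e) (hcop : IsCoprime (A * n ^ 2 + B * e ^ 2) (A * B))
    (hN : 1 < A * n ^ 2 + B * e ^ 2) :
    IsUniqueRep A B n e ↔ Prime (A * n ^ 2 + B * e ^ 2) := by
  refine ⟨fun hunique => ?_, fun hp => isUniqueRep_of_prime hp
    (fun hA => hp.not_isUnit (hcop.isUnit_of_dvd' dvd_rfl (hA.mul_right B))) hAB⟩
  by_contra hnp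
  obtain ⟨p, hp0, hp, v, hpv⟩ : ∃ p : ℤ, 0 < p ∧ Prime p ∧ p ∣ A * n ^ 2 + B * e ^ 2 := by
    obtain ⟨p, hp, hdvd⟩ := Int.exists_prime_and_dvd (by omega :
      (A * n ^ 2 + B * e ^ 2).natAbs ≠ 1)
    exact ⟨|p|, abs_pos.2 hp.ne_zero, hp.abs, (abs_dvd _ _).2 hdvd⟩
  have hv : 1 < v := by
    have hv0 : 0 < v := pos_of_mul_pos_right (by omega : 0 < p * v) hp0.le
    refine lt_of_le_of_ne hv0 fun h => hnp ?_
    rwa [hpv, ← h, mul_one]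
  have hpA : ¬ p ∣ A := fun h =>
    hp.not_isUnit (hcop.isUnit_of_dvd' ⟨v, hpv⟩ (h.mul_right B))
  obtain ⟨s, hs⟩ := exists_dvd_sq_add_mul hp hpA hne ⟨v, hpv⟩
  obtain ⟨C, E, a, b, hCE, hpab⟩ := hD.exists_rep_of_dvd_sq_add (by omega) hp0 hs
  obtain ⟨α, β, ⟨γ, rfl⟩, ⟨δ, rfl⟩, rfl⟩ := exists_dvd_and_dvd_of_dvd_mul
    (⟨B, hCE⟩ : A ∣ C * E)
  obtain rfl : B = γ * δ := mul_left_cancel₀ (left_ne_zero_of_mul (by omega : α * β * B ≠ 0))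
    (by linear_combination -hCE)
  rw [hpv] at hcop
  exact not_isUniqueRep_of_prime_factor hne hcop hp hv hpv.symm hpab (by omega) hunique

theorem AllReducedDiagonal.isUniqueRep_natCast_iff {A B n e : ℕ}
    (hD : AllReducedDiagonal (A * B : ℕ)) (hD2 : 2 ≤ A * B) (hn : 0 < n) (he : 0 < e)
    (hne : n.Coprime e) (hAB : A.Coprime B) (hAe : A.Coprime e) (hBn : B.Coprime n) :
    IsUniqueRep A B n e ↔ (A * n ^ 2 + B * e ^ 2).Prime := by
  have hA0 : 0 < A := Nat.pos_of_mul_pos_right (by omega : 0 < A * B)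
  have hB0 : 0 < B := Nat.pos_of_mul_pos_left (by omega : 0 < A * B)
  have hN : 1 < A * n ^ 2 + B * e ^ 2 := by
    have hAn : 0 < A * n ^ 2 := by positivity
    have hBe : 0 < B * e ^ 2 := by positivity
    omega
  have hcopA : (A * n ^ 2 + B * e ^ 2).Coprime A := by
    rw [Nat.coprime_mul_left_add_left]
    exact (hAB.mul_right (hAe.pow_right 2)).symm
  have hcopB : (A * n ^ 2 + B * e ^ 2).Coprime B := by
    rw [Nat.coprime_add_mul_left_left]
    exact (hAB.symm.mul_right (hBn.pow_right 2)).symm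
  rw [Nat.prime_iff_prime_int]
  push_cast at hD ⊢
  exact hD.isUniqueRep_iff_prime (mod_cast hD2) hne.isCoprime
    (mod_cast (hcopA.mul_right hcopB).isCoprime) (mod_cast hN)

theorem isUniqueRep_mul_iff {A B q n e : ℤ} (hq : Prime q) (hA : ¬ q ∣ A) :
    IsUniqueRep A (q * B) (q * n) e ↔ IsUniqueRep (A * q) B n e := by
  constructor
  · intro h x y hxy
    have hx := h (q * x) y (by linear_combination q * hxy)
    exact mul_left_cancel₀ (pow_ne_zero 2 hq.ne_zero) (by linear_combination hx)
  · intro h x y hxy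
    have hAx : q ∣ A * x ^ 2 :=
      ⟨A * q * n ^ 2 + B * e ^ 2 - B * y ^ 2, by linear_combination hxy⟩
    obtain ⟨z, rfl⟩ := hq.dvd_of_dvd_pow ((hq.dvd_or_dvd hAx).resolve_left hA)
    have hz := h z y (mul_left_cancel₀ hq.ne_zero (by linear_combination hxy))
    linear_combination q ^ 2 * hz

/-- The form `A x ^ 2 + B y ^ 2` takes values divisible by `q ^ 2` only at multiples of `q`. For a
prime `q` this makes the form anisotropic over the `q`-adic field. It lets common factors of the two
variables be cancelled in questions about all representations. -/
def IsAnisotropicAt (A B q : ℤ) : Prop :=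
  ∀ x y : ℤ, q ^ 2 ∣ A * x ^ 2 + B * y ^ 2 → q ∣ x ∧ q ∣ y

theorem isAnisotropicAt_one (A B : ℤ) : IsAnisotropicAt A B 1 :=
  fun x y _ => ⟨one_dvd x, one_dvd y⟩

theorem IsAnisotropicAt.mul {A B q r : ℤ} (hq : IsAnisotropicAt A B q)
    (hr : IsAnisotropicAt A B r) (hq0 : q ≠ 0) : IsAnisotropicAt A B (q * r) := by
  intro x y hdvd
  obtain ⟨⟨x, rfl⟩, ⟨y, rfl⟩⟩ := hq x y ((pow_dvd_pow_of_dvd (dvd_mul_right q r) 2).trans hdvd)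
  have hscale : A * (q * x) ^ 2 + B * (q * y) ^ 2 = q ^ 2 * (A * x ^ 2 + B * y ^ 2) := by ring
  rw [hscale, mul_pow, mul_dvd_mul_iff_left (pow_ne_zero 2 hq0)] at hdvd
  exact (hr x y hdvd).imp (mul_dvd_mul_left q) (mul_dvd_mul_left q)

theorem IsAnisotropicAt.of_forall_prime_dvd {A B : ℤ} {e : ℕ} (he : e ≠ 0)
    (h : ∀ q : ℕ, q.Prime → q ∣ e → IsAnisotropicAt A B q) : IsAnisotropicAt A B e := by
  induction e using induction_on_primes with
  | zero => exact absurd rfl he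
  | one => exact isAnisotropicAt_one A B
  | prime_mul q e hq ih =>
    push_cast
    exact (h q hq (dvd_mul_right q e)).mul (ih (right_ne_zero_of_mul he) fun r hr hre =>
      h r hr (hre.mul_left q)) (mod_cast hq.ne_zero)

theorem IsAnisotropicAt.of_dvd {A B e g : ℤ} (he : IsAnisotropicAt A B e) (he0 : e ≠ 0)
    (hg : g ∣ e) : IsAnisotropicAt A B g := by
  obtain ⟨k, rfl⟩ := hg
  have hk : k ≠ 0 := right_ne_zero_of_mul he0
  intro x y ⟨c, hc⟩
  obtain ⟨hx, hy⟩ := he (x * k) (y * k) ⟨c, by linear_combination k ^ 2 * hc⟩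
  exact ⟨(mul_dvd_mul_iff_right hk).1 hx, (mul_dvd_mul_iff_right hk).1 hy⟩

theorem isAnisotropicAt_of_not_isSquare {A B : ℤ} {p : ℕ} (hp : p.Prime)
    (h : ¬ IsSquare ((-(A * B) : ℤ) : ZMod p)) : IsAnisotropicAt A B p := by
  have := Fact.mk hp
  intro x y hdvd
  have hmod : (A : ZMod p) * x ^ 2 + B * y ^ 2 = 0 := by
    exact_mod_cast (ZMod.intCast_zmod_eq_zero_iff_dvd _ p).2
      ((dvd_pow_self (p : ℤ) two_ne_zero).trans hdvd)
  push_cast at h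
  have hA : (A : ZMod p) ≠ 0 := fun hA => h ⟨0, by rw [hA]; ring⟩
  have hy : (y : ZMod p) = 0 := by
    by_contra hy
    refine h ⟨A * x / y, ?_⟩
    field_simp
    linear_combination -hmod
  have hx : (x : ZMod p) = 0 := by simpa [hy, hA] using hmod
  exact ⟨(ZMod.intCast_zmod_eq_zero_iff_dvd x p).1 hx,
    (ZMod.intCast_zmod_eq_zero_iff_dvd y p).1 hy⟩

theorem isAnisotropicAt_of_not_dvd {A B p : ℤ} (hp : Prime p) (hA : ¬ p ∣ A) (hB : ¬ p ∣ B) :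
    IsAnisotropicAt A (p * B) p := by
  rintro x y ⟨c, hc⟩
  have hAx : p ∣ A * x ^ 2 := ⟨p * c - B * y ^ 2, by linear_combination hc⟩
  have hx : p ∣ x := hp.dvd_of_dvd_pow ((hp.dvd_or_dvd hAx).resolve_left hA)
  refine ⟨hx, ?_⟩
  obtain ⟨x, rfl⟩ := hx
  have hBy : p ∣ B * y ^ 2 :=
    ⟨c - A * x ^ 2, mul_left_cancel₀ hp.ne_zero (by linear_combination hc)⟩
  exact hp.dvd_of_dvd_pow ((hp.dvd_or_dvd hBy).resolve_left hB)

theorem IsAnisotropicAt.isUniqueRep_mul_right_iff {A B q n e : ℤ} (hq : IsAnisotropicAt A B q)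
    (hq0 : q ≠ 0) : IsUniqueRep A B (n * q) (e * q) ↔ IsUniqueRep A B n e := by
  have hq2 : q ^ 2 ≠ 0 := pow_ne_zero 2 hq0
  constructor
  · intro h x y hxy
    have hx := h (x * q) (y * q) (by linear_combination q ^ 2 * hxy)
    exact mul_left_cancel₀ hq2 (by linear_combination hx)
  · intro h x y hxy
    obtain ⟨⟨x, rfl⟩, ⟨y, rfl⟩⟩ :=
      hq x y ⟨A * n ^ 2 + B * e ^ 2, by linear_combination hxy⟩
    have hx := h x y (mul_left_cancel₀ hq2 (by linear_combination hxy))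
    linear_combination q ^ 2 * hx

theorem exists_mem_scaledPrimes_iff {A B g n e k : ℕ} (hg : 0 < g) (he : 0 < e)
    (hne : n.Coprime e) (hA : A.Coprime (e * g)) :
    (∃ d ∈ (e * g).divisors, k.Coprime (e * g / d) ∧
        A * (n * g) ^ 2 + B * (e * g) ^ 2 ∈ scaledPrimes (d ^ 2 * k)) ↔
      k.Coprime e ∧ A * n ^ 2 + B * e ^ 2 ∈ scaledPrimes k := by
  constructor
  · rintro ⟨d, hd, hk, p, hp, hpd⟩
    have hde : d ∣ e * g := Nat.dvd_of_mem_divisors hd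
    have hdA : d ^ 2 ∣ A * (n * g) ^ 2 :=
      (Nat.dvd_add_left ((pow_dvd_pow_of_dvd hde 2).mul_left B)).1
        ⟨k * p, by rw [← hpd]; ring⟩
    have hdn : d ∣ n * g := (Nat.pow_dvd_pow_iff two_ne_zero).1
      (((hA.symm.coprime_dvd_left hde).pow_left 2).dvd_of_dvd_mul_left hdA)
    obtain ⟨h, rfl⟩ : d ∣ g := by
      have hgcd := Nat.dvd_gcd hdn hde
      rwa [Nat.gcd_mul_right, hne, one_mul] at hgcd
    have hd0 : 0 < d := Nat.pos_of_mul_pos_right hg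
    rw [mul_left_comm, Nat.mul_div_cancel_left _ hd0] at hk
    have hcancel : h ^ 2 * (A * n ^ 2 + B * e ^ 2) = k * p :=
      Nat.eq_of_mul_eq_mul_left (pow_pos hd0 2) (by linear_combination -hpd)
    have hhp : h * h ∣ p := by
      rw [← pow_two]
      exact (hk.coprime_mul_left_right.symm.pow_left 2).dvd_of_dvd_mul_left ⟨_, hcancel.symm⟩
    obtain rfl : h = 1 := Nat.isUnit_iff.1 ((show p.Prime from hp).prime.squarefree h hhp)
    exact ⟨by simpa using hk, p, hp, by simpa using hcancel.symm⟩
  · rintro ⟨hk, p, hp, hpk⟩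
    refine ⟨g, Nat.mem_divisors.2 ⟨dvd_mul_left g e, (Nat.mul_pos he hg).ne'⟩, ?_, p, hp, ?_⟩
    · rwa [Nat.mul_div_cancel e hg]
    · dsimp only at hpk ⊢
      linear_combination g ^ 2 * hpk

theorem primeSet_eq_scaledPrimes_one : primeSet = scaledPrimes 1 := by
  simp [scaledPrimes]

theorem mem_scaledPrimes_one {N : ℕ} : N ∈ scaledPrimes 1 ↔ N.Prime := by
  rw [← primeSet_eq_scaledPrimes_one]
  rfl

theorem mul_mem_scaledPrimes_iff {k N : ℕ} (hk : 0 < k) : k * N ∈ scaledPrimes k ↔ N.Prime := by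
  simp [scaledPrimes, primeSet, hk.ne']

theorem AllReducedDiagonal.isUniqueRep_one_iff {D n e : ℕ} (hD : AllReducedDiagonal D)
    (hD2 : 2 ≤ D) (hn : 0 < n) (he : 0 < e) (hDe : D.Coprime e) (haniso : IsAnisotropicAt D 1 e) :
    IsUniqueRep D 1 n e ↔ ∃ d ∈ e.divisors, D * n ^ 2 + e ^ 2 ∈ scaledPrimes (d ^ 2) := by
  obtain ⟨g, n, e, hg, hne, rfl, rfl⟩ := Nat.exists_coprime' (Nat.gcd_pos_of_pos_left e hn)
  have hscaled := exists_mem_scaledPrimes_iff (B := 1) (k := 1) hg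
    (Nat.pos_of_mul_pos_right he) hne hDe
  have heuler := AllReducedDiagonal.isUniqueRep_natCast_iff (by rwa [mul_one]) (by rwa [mul_one])
    (Nat.pos_of_mul_pos_right hn) (Nat.pos_of_mul_pos_right he) hne D.coprime_one_right
    hDe.coprime_mul_right_right n.coprime_one_left
  simp only [Nat.coprime_one_left_iff, true_and, mul_one, one_mul, mem_scaledPrimes_one]
    at hscaled heuler
  rw [hscaled, ← heuler]
  push_cast
  exact (haniso.of_dvd (mod_cast he.ne') ⟨e, by push_cast; ring⟩).isUniqueRep_mul_right_iff
    (mod_cast hg.ne')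

theorem AllReducedDiagonal.isUniqueRep_prime_iff_of_coprime {A r n e : ℕ} (hr : r.Prime)
    (hAr : A.Coprime r) (hD : AllReducedDiagonal (A * r : ℕ)) (hn : 0 < n) (he : 0 < e)
    (hne : n.Coprime e) (hAe : A.Coprime e) :
    IsUniqueRep A r n e ↔ A * n ^ 2 + r * e ^ 2 ∈ scaledPrimes 1 ∨
      r.Coprime e ∧ A * n ^ 2 + r * e ^ 2 ∈ scaledPrimes r := by
  have hrA : ¬ r ∣ A := hr.coprime_iff_not_dvd.1 hAr.symm
  have hA0 : 0 < A := Nat.pos_of_ne_zero fun h => hrA (h ▸ dvd_zero r)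
  have hAr2 : 2 ≤ A * r := by nlinarith [hr.two_le]
  rw [mem_scaledPrimes_one]
  by_cases hrn : r ∣ n
  · obtain ⟨m, rfl⟩ := hrn
    have hm : 0 < m := Nat.pos_of_mul_pos_left hn
    have hre : r.Coprime e := hne.coprime_mul_right
    have heuler : IsUniqueRep ↑(A * r) (1 : ℕ) m e ↔ (A * r * m ^ 2 + 1 * e ^ 2).Prime :=
      AllReducedDiagonal.isUniqueRep_natCast_iff (by rwa [mul_one]) (by rwa [mul_one]) hm he
        hne.coprime_mul_left (A * r).coprime_one_right (hAe.mul_left hre) m.coprime_one_left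
    have hfactor : A * (r * m) ^ 2 + r * e ^ 2 = r * (A * r * m ^ 2 + 1 * e ^ 2) := by ring
    have hnot : ¬ (r * (A * r * m ^ 2 + 1 * e ^ 2)).Prime :=
      Nat.not_prime_mul hr.ne_one (by nlinarith [Nat.pow_pos (n := 2) hm, Nat.pow_pos (n := 2) he])
    rw [hfactor, mul_mem_scaledPrimes_iff hr.pos, or_iff_right hnot, and_iff_right hre, ← heuler]
    push_cast
    simpa only [mul_one] using isUniqueRep_mul_iff (B := 1) (n := m) (e := e)
      (Nat.prime_iff_prime_int.1 hr) (mod_cast hrA)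
  · have hnot : A * n ^ 2 + r * e ^ 2 ∉ scaledPrimes r := by
      rintro ⟨p, -, hp⟩
      have hdvd : r ∣ A * n ^ 2 := (Nat.dvd_add_left (dvd_mul_right r _)).1 ⟨p, hp.symm⟩
      exact hrn (hr.dvd_of_dvd_pow (hAr.symm.dvd_of_dvd_mul_left hdvd))
    rw [hD.isUniqueRep_natCast_iff hAr2 hn he hne hAr hAe (hr.coprime_iff_not_dvd.2 hrn)]
    simp only [hnot, and_false, or_false]

theorem AllReducedDiagonal.isUniqueRep_prime_iff {A r n e : ℕ} (hr : r.Prime)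
    (hAr : A.Coprime r) (hD : AllReducedDiagonal (A * r : ℕ)) (hn : 0 < n) (he : 0 < e)
    (hAe : A.Coprime e) (haniso : IsAnisotropicAt A r e) :
    IsUniqueRep A r n e ↔ ∃ d ∈ e.divisors, A * n ^ 2 + r * e ^ 2 ∈ scaledPrimes (d ^ 2) ∨
      r.Coprime (e / d) ∧ A * n ^ 2 + r * e ^ 2 ∈ scaledPrimes (d ^ 2 * r) := by
  obtain ⟨g, n, e, hg, hne, rfl, rfl⟩ := Nat.exists_coprime' (Nat.gcd_pos_of_pos_left e hn)
  have he0 : 0 < e := Nat.pos_of_mul_pos_right he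
  have hunramified := exists_mem_scaledPrimes_iff (B := r) (k := 1) hg he0 hne hAe
  have hramified := exists_mem_scaledPrimes_iff (B := r) (k := r) hg he0 hne hAe
  simp only [Nat.coprime_one_left_iff, true_and, mul_one] at hunramified
  simp only [and_or_left, exists_or]
  rw [hunramified, hramified, ← hD.isUniqueRep_prime_iff_of_coprime hr hAr
    (Nat.pos_of_mul_pos_right hn) he0 hne hAe.coprime_mul_right_right]
  push_cast
  exact (haniso.of_dvd (mod_cast he.ne') ⟨e, by push_cast; ring⟩).isUniqueRep_mul_right_iff
    (mod_cast hg.ne')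

theorem exists_natCast_eq_polygonal {m : ℕ} (hm : 3 ≤ m) (c : ℤ) :
    ∃ k : ℕ, polygonal m c = k := by
  obtain ⟨w, hw⟩ := (Int.even_mul_pred_self c).two_dvd
  have hw0 : 0 ≤ w := by
    rcases le_or_gt c 0 with hc | hc <;> nlinarith
  have hwc : 0 ≤ w + c := by
    rcases le_or_gt 0 c with hc | hc <;> nlinarith
  obtain ⟨l, rfl⟩ := Nat.exists_eq_add_of_le hm
  lift w to ℕ using hw0
  lift w + c to ℕ using hwc with u hu
  refine ⟨l * w + u, ?_⟩
  qify at hw hu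
  unfold polygonal
  push_cast
  linear_combination ((l : ℚ) + 1) / 2 * hw - hu

theorem exists_eq_add_two_mul_of_sq_eq {n y w : ℕ} (h : n ^ 2 = y ^ 2 + 4 * w) :
    ∃ a, n = y + 2 * a ∧ a * (a + y) = w := by
  obtain ⟨d, rfl⟩ := Nat.exists_eq_add_of_le
    ((Nat.pow_le_pow_iff_left two_ne_zero).1 (by omega : y ^ 2 ≤ n ^ 2))
  obtain ⟨a, rfl⟩ : 2 ∣ d := Nat.prime_two.dvd_of_dvd_pow (n := 2)
    ((Nat.dvd_add_right (dvd_mul_right 2 (y * d))).1 ⟨2 * w, by linear_combination h⟩)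
  exact ⟨a, rfl, by linarith⟩

/-- The substitution is `x = b - a`, so that `n ^ 2 = x ^ 2 + 4 a b`. -/
theorem polyRepr_eq_zero_iff_forall {m t n : ℕ} (hm : 3 ≤ m) :
    polyRepr m t n = 0 ↔ ∀ x c : ℤ, IsPolygonalIndex m c →
      (n : ℚ) ^ 2 = x ^ 2 + 4 * t * polygonal m c → x ^ 2 = n ^ 2 := by
  simp only [polyRepr, Finset.card_eq_zero, Finset.filter_eq_empty_iff, Prod.forall,
    Finset.HasAntidiagonal.mem_antidiagonal, not_and, not_exists]
  constructor
  · intro h x c hc hx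
    obtain ⟨k, hk⟩ := exists_natCast_eq_polygonal hm c
    rw [hk, ← sq_abs (x : ℚ), ← Int.cast_abs] at hx
    rw [← sq_abs x]
    lift |x| to ℕ using abs_nonneg x with y
    obtain ⟨a, rfl, hak⟩ := exists_eq_add_two_mul_of_sq_eq
      (by rw [mul_assoc] at hx; exact_mod_cast hx : n ^ 2 = y ^ 2 + 4 * (t * k))
    rcases a.eq_zero_or_pos with rfl | ha
    · rfl
    · exact absurd (by rw [hk]; exact_mod_cast hak)
        (h a (a + y) (by omega) ha (by omega) (by omega) c hc)
  · rintro h a b rfl ha hb - c hc hab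
    have hsq := h (b - a) c hc (by push_cast; linear_combination 4 * hab)
    push_cast at hsq
    nlinarith

theorem sq_eq_sq_add_polygonal_iff {m t : ℕ} (hm : m ≠ 2) {n x c : ℤ} :
    (n : ℚ) ^ 2 = x ^ 2 + 4 * t * polygonal m c ↔
      2 * ((m : ℤ) - 2) * x ^ 2 + t * (2 * (m - 2) * c - (m - 4)) ^ 2 =
        2 * (m - 2) * n ^ 2 + t * (m - 4) ^ 2 := by
  have hm2 : 2 * ((m : ℚ) - 2) ≠ 0 := by
    simpa [sub_eq_zero] using (mod_cast hm : (m : ℚ) ≠ 2)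
  rw [← mul_right_inj' hm2]
  unfold polygonal
  qify
  constructor <;> intro h <;> linear_combination -h

theorem polyRepr_eq_zero_iff {m t n : ℕ} (hm : 3 ≤ m) :
    polyRepr m t n = 0 ↔ ∀ x c : ℤ, IsPolygonalIndex m c →
      2 * ((m : ℤ) - 2) * x ^ 2 + t * (2 * (m - 2) * c - (m - 4)) ^ 2 =
        2 * (m - 2) * n ^ 2 + t * (m - 4) ^ 2 → x ^ 2 = n ^ 2 := by
  rw [polyRepr_eq_zero_iff_forall hm]
  simp only [← sq_eq_sq_add_polygonal_iff (by omega : m ≠ 2), Int.cast_natCast]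

theorem polyRepr_three_eq_zero_iff {t n : ℕ} :
    polyRepr 3 t n = 0 ↔ ∀ x y : ℤ, Odd y →
      2 * x ^ 2 + t * y ^ 2 = 2 * n ^ 2 + t → x ^ 2 = n ^ 2 := by
  rw [polyRepr_eq_zero_iff le_rfl]
  push_cast
  constructor
  · rintro h x y hy hxy
    rw [← sq_abs y] at hxy
    obtain ⟨c, hc⟩ := odd_abs.2 hy
    rcases (show 0 ≤ c by have := abs_nonneg y; omega).eq_or_lt with rfl | hc0
    · rw [hc] at hxy
      linarith
    · exact h x c (Or.inr hc0) (by rw [hc] at hxy; linear_combination hxy)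
  · rintro h x c - hxc
    exact h x (2 * c + 1) ⟨c, rfl⟩ (by linear_combination hxc)

theorem exists_sq_eq_of_dvd_sq_sub_sq {p : ℕ} (hp : p.Prime) (hp2 : p ≠ 2) {e y : ℤ}
    (heven : Even (y - e)) (hdvd : (p : ℤ) ∣ y ^ 2 - e ^ 2) :
    ∃ c : ℤ, (2 * p * c - e) ^ 2 = y ^ 2 := by
  have hcop : IsCoprime (2 : ℤ) p :=
    mod_cast ((Nat.coprime_primes Nat.prime_two hp).2 hp2.symm).isCoprime
  rw [sq_sub_sq] at hdvd
  rcases (Nat.prime_iff_prime_int.1 hp).dvd_or_dvd hdvd with h | h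
  · obtain ⟨c, hc⟩ := hcop.mul_dvd (by have := heven.two_dvd; omega) h
    exact ⟨c, by rw [← hc, add_sub_cancel_right]⟩
  · obtain ⟨c, hc⟩ := hcop.mul_dvd heven.two_dvd h
    exact ⟨-c, by linear_combination -(2 * p * c + y + e) * hc⟩

theorem even_sub_of_even_sq_sub_sq {a b : ℤ} (h : Even (a ^ 2 - b ^ 2)) : Even (a - b) := by
  simpa only [Int.even_sub, Int.even_pow' two_ne_zero] using h

theorem polyRepr_prime_add_two_eq_zero_iff {p n : ℕ} (hp : p.Prime) (hp2 : p ≠ 2) :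
    polyRepr (p + 2) 1 n = 0 ↔ IsUniqueRep (2 * p : ℕ) 1 n (p - 2 : ℕ) := by
  obtain ⟨e, rfl⟩ := Nat.exists_eq_add_of_le' hp.two_le
  rw [polyRepr_eq_zero_iff (by omega), IsUniqueRep, Nat.add_sub_cancel]
  push_cast
  constructor
  · rintro h x y hxy
    have hsub : Even (y - e) := even_sub_of_even_sq_sub_sq
      ⟨(e + 2) * (n ^ 2 - x ^ 2), by linear_combination hxy⟩
    obtain ⟨c, hc⟩ := exists_sq_eq_of_dvd_sq_sub_sq hp hp2 hsub
      ⟨2 * (n ^ 2 - x ^ 2), by push_cast; linear_combination hxy⟩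
    push_cast at hc
    exact h x c (Or.inl (by omega)) (by linear_combination hxy + hc)
  · rintro h x c - hxc
    exact h x (2 * (e + 2) * c - e) (by linear_combination hxc)

theorem even_sub_of_mul_sq_add_two_mul_sq_eq {p n e x y : ℤ} (hp : Odd p)
    (h : p * x ^ 2 + 2 * y ^ 2 = p * n ^ 2 + 2 * e ^ 2) : Even (y - e) := by
  have hpnx : Even (p * (n ^ 2 - x ^ 2)) := ⟨y ^ 2 - e ^ 2, by linear_combination -h⟩
  obtain ⟨d, hd⟩ := even_sub_of_even_sq_sub_sq
    ((Int.even_mul.1 hpnx).resolve_left (Int.not_even_iff_odd.2 hp))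
  obtain rfl : n = x + 2 * d := by linarith
  exact even_sub_of_even_sq_sub_sq ⟨p * d * (d + x), by linarith⟩

theorem polyRepr_two_mul_prime_add_two_eq_zero_iff {p n : ℕ} (hp : p.Prime) (hp2 : p ≠ 2) :
    polyRepr (2 * p + 2) 2 n = 0 ↔ IsUniqueRep p (2 : ℕ) n (p - 1 : ℕ) := by
  obtain ⟨e, he⟩ : ∃ e : ℤ, e = (p - 1 : ℕ) := ⟨_, rfl⟩
  have hpe : (p : ℤ) - 1 = e := by have := hp.pos; omega
  have hp_not_dvd : ¬ (p : ℤ) ∣ 2 :=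
    mod_cast mt (Nat.prime_dvd_prime_iff_eq hp Nat.prime_two).1 hp2
  rw [polyRepr_eq_zero_iff (by have := hp.pos; omega), IsUniqueRep, ← he]
  push_cast
  constructor
  · rintro h x y hxy
    have hdvd : (p : ℤ) ∣ 2 * (y ^ 2 - e ^ 2) := ⟨n ^ 2 - x ^ 2, by linear_combination hxy⟩
    obtain ⟨c, hc⟩ := exists_sq_eq_of_dvd_sq_sub_sq hp hp2
      (even_sub_of_mul_sq_add_two_mul_sq_eq (mod_cast hp.odd_of_ne_two hp2) hxy)
      (((Nat.prime_iff_prime_int.1 hp).dvd_or_dvd hdvd).resolve_left hp_not_dvd)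
    refine h x c (Or.inl (by have := hp.two_le; omega)) ?_
    rw [← hpe] at hxy hc
    linear_combination 4 * hxy + 8 * hc
  · rintro h x c - hxc
    refine h x (2 * p * c - e) ?_
    rw [← hpe]
    linarith

theorem polyRepr_three_odd_eq_zero_iff {t n : ℕ} (ht : Odd t) :
    polyRepr 3 t n = 0 ↔ IsUniqueRep 2 t n 1 := by
  rw [polyRepr_three_eq_zero_iff, IsUniqueRep]
  refine forall₂_congr fun x y => ⟨fun h hxy => h ?_ (by linear_combination hxy),
    fun h _ hxy => h (by linear_combination hxy)⟩
  have hodd : Odd ((t : ℤ) * y ^ 2) := by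
    have : (t : ℤ) * y ^ 2 = t + 2 * (n ^ 2 - x ^ 2) := by linear_combination hxy
    rw [this]
    exact Odd.add_even (mod_cast ht) (even_two_mul _)
  exact (Int.odd_pow' two_ne_zero).1 (Int.odd_mul.1 hodd).2

theorem polyRepr_three_two_even_eq_zero_iff {k : ℕ} :
    polyRepr 3 2 (2 * k) = 0 ↔ IsUniqueRep 4 1 k 1 := by
  rw [polyRepr_three_eq_zero_iff, IsUniqueRep]
  push_cast
  constructor
  · intro h x y hxy
    have hy : Odd (y ^ 2) := ⟨2 * (k ^ 2 - x ^ 2), by linear_combination hxy⟩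
    have := h (2 * x) y ((Int.odd_pow' two_ne_zero).1 hy) (by linear_combination 2 * hxy)
    linarith
  · rintro h x y ⟨w, rfl⟩ hxy
    obtain ⟨z, rfl⟩ : Even x := by
      have : Even (x ^ 2) := ⟨2 * (k ^ 2 - w ^ 2 - w), by linarith⟩
      exact (Int.even_pow' two_ne_zero).1 this
    have := h z (2 * w + 1) (by linarith)
    linear_combination 4 * this

theorem polyRepr_three_two_odd_eq_zero_iff {k : ℕ} : polyRepr 3 2 (2 * k + 1) = 0 ↔ k = 0 := by
  rw [polyRepr_three_eq_zero_iff]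
  push_cast
  constructor
  · intro h
    have hk := h 1 (2 * k + 1) ⟨k, rfl⟩ (by ring)
    nlinarith
  · rintro rfl x y ⟨w, rfl⟩ hxy
    have hw : 0 ≤ w * (w + 1) := by rcases lt_or_ge w 0 <;> nlinarith
    have hsum : x ^ 2 + 4 * (w * (w + 1)) = 1 := by push_cast at hxy; linarith
    have hx : 0 ≤ x ^ 2 := sq_nonneg x
    push_cast
    omega

theorem isAnisotropicAt_two_mul_one {p e : ℕ} (hpe : p = e + 2) (he : e ≠ 0)
    (h : ∀ q ∈ e.primeFactors, q % 4 = 3) : IsAnisotropicAt (2 * p : ℕ) 1 e := by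
  refine .of_forall_prime_dvd he fun q hq hqe => isAnisotropicAt_of_not_isSquare hq ?_
  have hq4 : q % 4 = 3 := h q (Nat.mem_primeFactors.2 ⟨hq, hqe, he⟩)
  have := Fact.mk hq
  have hmod : ((-((2 * p : ℕ) * 1) : ℤ) : ZMod q) = -1 * 2 ^ 2 := by
    rw [hpe]
    push_cast
    rw [(ZMod.natCast_eq_zero_iff e q).2 hqe]
    ring
  have htwo : (2 : ZMod q) ≠ 0 := Ring.two_ne_zero (by rw [ZMod.ringChar_zmod_n]; rintro rfl; omega)
  rw [hmod]
  rintro ⟨s, hs⟩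
  refine ZMod.exists_sq_eq_neg_one_iff.1 ⟨s / 2, ?_⟩ hq4
  field_simp
  linear_combination hs

theorem isAnisotropicAt_two {p e : ℕ} (hpe : p = e + 1) (he : e ≠ 0)
    (h : ∀ q ∈ e.primeFactors, q = 2 ∨ q % 8 = 5 ∨ q % 8 = 7) : IsAnisotropicAt p 2 e := by
  refine .of_forall_prime_dvd he fun q hq hqe => ?_
  have := Fact.mk hq
  rcases h q (Nat.mem_primeFactors.2 ⟨hq, hqe, he⟩) with rfl | hq8
  · exact isAnisotropicAt_of_not_dvd (B := 1) Int.prime_two (by omega) (by decide)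
  · have hmod : ((-(p * 2) : ℤ) : ZMod q) = -2 := by
      rw [hpe]
      push_cast
      rw [(ZMod.natCast_eq_zero_iff e q).2 hqe]
      ring
    refine isAnisotropicAt_of_not_isSquare hq ?_
    rw [hmod, ZMod.exists_sq_eq_neg_two_iff (by rintro rfl; omega)]
    omega

theorem polyRepr_prime_add_two_eq_zero_iff_exists {p n : ℕ} (hp : p.Prime) (hp2 : p ≠ 2)
    (hn : 0 < n) (hD : AllReducedDiagonal (2 * p : ℕ)) (h : ∀ q ∈ (p - 2).primeFactors, q % 4 = 3) :
    polyRepr (p + 2) 1 n = 0 ↔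
      ∃ d ∈ (p - 2).divisors, 2 * p * n ^ 2 + (p - 2) ^ 2 ∈ scaledPrimes (d ^ 2) := by
  have hle : 2 ≤ p := hp.two_le
  have hcop : (2 * p).Coprime (p - 2) := by
    have hp_two : p.Coprime 2 := (Nat.coprime_primes hp Nat.prime_two).2 hp2
    have hsub_two : (p - 2).Coprime 2 := (Nat.coprime_sub_self_left hle).2 hp_two
    exact hsub_two.symm.mul_left ((Nat.coprime_self_sub_right hle).2 hp_two)
  rw [polyRepr_prime_add_two_eq_zero_iff hp hp2]
  exact hD.isUniqueRep_one_iff (by omega) hn (by omega) hcop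
    (isAnisotropicAt_two_mul_one (by omega) (by omega) h)

theorem polyRepr_two_mul_prime_add_two_eq_zero_iff_exists {p n : ℕ} (hp : p.Prime) (hp2 : p ≠ 2)
    (hn : 0 < n) (hD : AllReducedDiagonal (2 * p : ℕ))
    (h : ∀ q ∈ (p - 1).primeFactors, q = 2 ∨ q % 8 = 5 ∨ q % 8 = 7) :
    polyRepr (2 * p + 2) 2 n = 0 ↔
      ∃ d ∈ (p - 1).divisors, p * n ^ 2 + 2 * (p - 1) ^ 2 ∈ scaledPrimes (d ^ 2) ∨
        Nat.Coprime 2 ((p - 1) / d) ∧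
          p * n ^ 2 + 2 * (p - 1) ^ 2 ∈ scaledPrimes (d ^ 2 * 2) := by
  have hlt : 1 < p := hp.one_lt
  rw [mul_comm] at hD
  rw [polyRepr_two_mul_prime_add_two_eq_zero_iff hp hp2]
  exact hD.isUniqueRep_prime_iff Nat.prime_two ((Nat.coprime_primes hp Nat.prime_two).2 hp2) hn
    (by omega) ((Nat.coprime_self_sub_right hlt.le).2 p.coprime_one_right)
    (isAnisotropicAt_two (by omega) (by omega) h)

theorem polyRepr_three_one_eq_zero_iff {n : ℕ} (hn : 0 < n) :
    polyRepr 3 1 n = 0 ↔ (2 * n ^ 2 + 1).Prime := by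
  have hD : AllReducedDiagonal (2 * 1 : ℕ) := allReducedDiagonal_of_forall_not_dvd (by decide)
  rw [polyRepr_three_odd_eq_zero_iff odd_one]
  exact hD.isUniqueRep_natCast_iff le_rfl hn one_pos n.coprime_one_right
    (Nat.coprime_one_right 2) (Nat.coprime_one_right 2) n.coprime_one_left

theorem polyRepr_three_two_eq_zero_iff {n : ℕ} (hn : 0 < n) :
    polyRepr 3 2 n = 0 ↔ (n ^ 2 + 1).Prime := by
  rcases Nat.even_or_odd' n with ⟨k, rfl | rfl⟩
  · have hD : AllReducedDiagonal (4 * 1 : ℕ) := allReducedDiagonal_of_forall_not_dvd (by decide)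
    rw [polyRepr_three_two_even_eq_zero_iff,
      show (2 * k) ^ 2 + 1 = 4 * k ^ 2 + 1 * 1 ^ 2 by ring]
    exact hD.isUniqueRep_natCast_iff (by decide) (by omega) one_pos k.coprime_one_right
      (Nat.coprime_one_right 4) (Nat.coprime_one_right 4) k.coprime_one_left
  · rw [polyRepr_three_two_odd_eq_zero_iff,
      show (2 * k + 1) ^ 2 + 1 = 2 * (2 * (k ^ 2 + k) + 1) by ring]
    constructor
    · rintro rfl
      exact Nat.prime_two
    · intro hprime
      by_contra hk
      exact Nat.not_prime_mul (by decide) (by simpa using hk) hprime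

theorem polyRepr_three_prime_eq_zero_iff {p n : ℕ} (hp : p.Prime) (hp2 : p ≠ 2) (hn : 0 < n)
    (hD : AllReducedDiagonal (2 * p : ℕ)) :
    polyRepr 3 p n = 0 ↔ 2 * n ^ 2 + p ∈ primeSet ∪ scaledPrimes p := by
  have hunique := AllReducedDiagonal.isUniqueRep_prime_iff_of_coprime (e := 1) hp
    ((Nat.coprime_primes Nat.prime_two hp).2 hp2.symm) hD hn one_pos n.coprime_one_right
    (Nat.coprime_one_right 2)
  rw [polyRepr_three_odd_eq_zero_iff (hp.odd_of_ne_two hp2), primeSet_eq_scaledPrimes_one]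
  simpa using hunique

theorem allReducedDiagonal_two_mul {p : ℕ} (hp : p ∈ ({3, 5, 11, 29} : Finset ℕ)) :
    AllReducedDiagonal (2 * p : ℕ) :=
  allReducedDiagonal_of_forall_not_dvd (by revert p; decide +kernel)

theorem corollary1 (n : ℕ) (hn : 0 < n) :
    (polyRepr 3 1 n = 0 ↔
      2 * n ^ 2 + 1 ∈ primeSet) ∧
    (polyRepr 5 1 n = 0 ↔
      6 * n ^ 2 + 1 ∈ primeSet) ∧
    (polyRepr 7 1 n = 0 ↔
      10 * n ^ 2 + 9 ∈ primeSet ∪ scaledPrimes 9) ∧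
    (polyRepr 13 1 n = 0 ↔
      22 * n ^ 2 + 81 ∈ primeSet ∪ scaledPrimes 9 ∪ scaledPrimes 81) ∧
    (polyRepr 31 1 n = 0 ↔
      58 * n ^ 2 + 729 ∈ primeSet ∪ scaledPrimes 9 ∪ scaledPrimes 81 ∪ scaledPrimes 729) ∧
    (polyRepr 3 2 n = 0 ↔
      n ^ 2 + 1 ∈ primeSet) ∧
    (polyRepr 8 2 n = 0 ↔
      3 * n ^ 2 + 8 ∈ primeSet ∪ scaledPrimes 4 ∪ scaledPrimes 8) ∧
    (polyRepr 12 2 n = 0 ↔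
      5 * n ^ 2 + 32 ∈ primeSet ∪ scaledPrimes 4 ∪ scaledPrimes 16 ∪ scaledPrimes 32) ∧
    (polyRepr 24 2 n = 0 ↔
      11 * n ^ 2 + 200 ∈ primeSet ∪ scaledPrimes 4 ∪ scaledPrimes 8 ∪ scaledPrimes 25 ∪
        scaledPrimes 100 ∪ scaledPrimes 200) ∧
    (polyRepr 60 2 n = 0 ↔
      29 * n ^ 2 + 1568 ∈ primeSet ∪ scaledPrimes 4 ∪ scaledPrimes 16 ∪ scaledPrimes 32 ∪
        scaledPrimes 49 ∪ scaledPrimes 196 ∪ scaledPrimes 784 ∪ scaledPrimes 1568) ∧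
    (polyRepr 3 3 n = 0 ↔
      2 * n ^ 2 + 3 ∈ primeSet ∪ scaledPrimes 3) ∧
    (polyRepr 3 5 n = 0 ↔
      2 * n ^ 2 + 5 ∈ primeSet ∪ scaledPrimes 5) ∧
    (polyRepr 3 11 n = 0 ↔
      2 * n ^ 2 + 11 ∈ primeSet ∪ scaledPrimes 11) ∧
    (polyRepr 3 29 n = 0 ↔
      2 * n ^ 2 + 29 ∈ primeSet ∪ scaledPrimes 29) := by
  have hprime : ∀ p ∈ ({3, 5, 11, 29} : Finset ℕ), p.Prime ∧ p ≠ 2 := by decide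
  have one_case (p) (hp : p ∈ ({3, 5, 11, 29} : Finset ℕ)) :=
    polyRepr_prime_add_two_eq_zero_iff_exists (hprime p hp).1 (hprime p hp).2 hn
      (allReducedDiagonal_two_mul hp) (by revert p; decide +kernel)
  have two_case (p) (hp : p ∈ ({3, 5, 11, 29} : Finset ℕ)) :=
    polyRepr_two_mul_prime_add_two_eq_zero_iff_exists (hprime p hp).1 (hprime p hp).2 hn
      (allReducedDiagonal_two_mul hp) (by revert p; decide +kernel)
  have triangular_case (p) (hp : p ∈ ({3, 5, 11, 29} : Finset ℕ)) :=
    polyRepr_three_prime_eq_zero_iff (hprime p hp).1 (hprime p hp).2 hn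
      (allReducedDiagonal_two_mul hp)
  refine ⟨polyRepr_three_one_eq_zero_iff hn, (one_case 3 (by decide)).trans ?_,
    (one_case 5 (by decide)).trans ?_, (one_case 11 (by decide)).trans ?_,
    (one_case 29 (by decide)).trans ?_, polyRepr_three_two_eq_zero_iff hn,
    (two_case 3 (by decide)).trans ?_, (two_case 5 (by decide)).trans ?_,
    (two_case 11 (by decide)).trans ?_, (two_case 29 (by decide)).trans ?_,
    triangular_case 3 (by decide), triangular_case 5 (by decide),
    triangular_case 11 (by decide), triangular_case 29 (by decide)⟩ <;>
  simp [primeSet_eq_scaledPrimes_one, Nat.divisors_ofNat, Nat.odd_iff, or_assoc]
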